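/- Let $d\ge 0$ be an integer and let $f:\mathbb{R}^d\to[0,\infty)$ be a (Borel measurable) function with $$\int f(z)\,dz=1,\qquad \int z f(z)\,dz=0,\qquad \int \|z\|^2 f(z)\,dz<\infty ,$$ and consider the location family $p(z\mid\mu)=f(z-\mu)$, $\mu\in\mathbb{R}^d$. An observation $x\sim p(x\mid\mu)$ is used to predict $y\sim p(y\mid\mu)$ by a predictive density $\hat p(y\mid x)$, that is, a jointly measurable function that is a probability density in $y$ for every $x$. For probability distributions $P,Q$ on $\mathbb{R}^d$ let $W_2(P,Q)=\inf \mathrm{E}[\|X-Y\|^2]^{1/2}\in[0,\infty]$, the infimum being over all joint distributions of $(X,Y)$ with marginals $P$ and $Q$, and let the risk of $\hat p$ at $\mu$ be $$R(\mu,\hat p)=\int W_2\bigl(p(\cdot\mid\mu),\hat p(\cdot\mid x)\bigr)^2\,p(x\mid\mu)\,dx\in[0,\infty].$$ Call $\hat p$ equivariant if, for all $c,x\in\mathbb{R}^d$, $\hat p(y+c\mid x+c)=\hat p(y\mid x)$ for almost every $y$; call it best equivariant if it is equivariant and $R(\mu,\hat p)\le R(\mu,\hat q)$ for every $\mu$ and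 every equivariant predictive density $\hat q$; and call it minimax if $\sup_\mu R(\mu,\hat p)\le\sup_\mu R(\mu,\hat q)$ for every predictive density $\hat q$. Then the plug-in density $\hat p_*(y\mid x)=p(y\mid x)=f(y-x)$ with the usual estimator $\hat\mu(x)=x$ is best equivariant; it is the only best equivariant predictive density, in the sense that every best equivariant $\hat q$ satisfies, for every $x$, $\hat q(y\mid x)=f(y-x)$ for almost every $y$; and $\hat p_*$ is minimax. -/

import Mathlib

open MeasureTheory
open scoped ENNReal

noncomputable section

/-- A joint distribution on `S × S` with marginals `P` and `Q`. -/
def IsCoupling {S : Type*} [MeasurableSpace S] (P Q : Measure S) (γ : Measure (S × S)) : Prop :=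
  γ.map Prod.fst = P ∧ γ.map Prod.snd = Q

/-- The `L²` Wasserstein distance `inf E[d(X, Y)²]^{1/2}` over all joint distributions of `(X, Y)`
with marginals `P` and `Q`, with values in `[0, ∞]`. -/
def wassersteinTwo {S : Type*} [MeasurableSpace S] [PseudoEMetricSpace S]
    (P Q : Measure S) : ℝ≥0∞ :=
  ⨅ (γ : Measure (S × S)) (_ : IsCoupling P Q γ), (∫⁻ z, edist z.1 z.2 ^ 2 ∂γ) ^ (1 / 2 : ℝ)

/-- The distribution on `ℝ^d` with Lebesgue density `g`. -/
def distOf {d : ℕ} (g : EuclideanSpace ℝ (Fin d) → ℝ) : Measure (EuclideanSpace ℝ (Fin d)) :=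
  volume.withDensity fun z => ENNReal.ofReal (g z)

/-- The location family `p(z | μ) = f(z - μ)`. -/
def locDensity {d : ℕ} (f : EuclideanSpace ℝ (Fin d) → ℝ) (μ z : EuclideanSpace ℝ (Fin d)) : ℝ :=
  f (z - μ)

/-- `p x y` is a predictive density `p̂(y | x)`: jointly measurable, and for each observation `x` a
probability density in `y`. -/
structure IsPredictiveDensity {d : ℕ}
    (p : EuclideanSpace ℝ (Fin d) → EuclideanSpace ℝ (Fin d) → ℝ) : Prop where
  measurable : Measurable (Function.uncurry p)
  nonneg : ∀ x y, 0 ≤ p x y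
  integral_eq_one : ∀ x, ∫ y, p x y = 1

/-- The plug-in density `p(y | μ̂(x))`. -/
def plugIn {d : ℕ} (f : EuclideanSpace ℝ (Fin d) → ℝ)
    (est : EuclideanSpace ℝ (Fin d) → EuclideanSpace ℝ (Fin d))
    (x y : EuclideanSpace ℝ (Fin d)) : ℝ :=
  locDensity f (est x) y

/-- The risk `R(μ, p̂) = ∫ W₂(p(y | μ), p̂(y | x))² p(x | μ) dx`, with values in `[0, ∞]`. -/
def wassersteinRisk {d : ℕ} (f : EuclideanSpace ℝ (Fin d) → ℝ) (μ : EuclideanSpace ℝ (Fin d))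
    (p : EuclideanSpace ℝ (Fin d) → EuclideanSpace ℝ (Fin d) → ℝ) : ℝ≥0∞ :=
  ∫⁻ x, wassersteinTwo (distOf (locDensity f μ)) (distOf (p x)) ^ 2 ∂(distOf (locDensity f μ))

/-- Equivariance under the translations `(x, y, μ) ↦ (x + c, y + c, μ + c)`; since `p x` matters
only as the density of a distribution, the identity is required for almost every `y`. -/
def IsEquivariant {d : ℕ}
    (p : EuclideanSpace ℝ (Fin d) → EuclideanSpace ℝ (Fin d) → ℝ) : Prop :=
  ∀ c x, ∀ᵐ y, p (x + c) (y + c) = p x y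

/-- `p` is an equivariant predictive density whose risk is, at every parameter value, minimal among
all equivariant predictive densities. -/
structure IsBestEquivariant {d : ℕ} (f : EuclideanSpace ℝ (Fin d) → ℝ)
    (p : EuclideanSpace ℝ (Fin d) → EuclideanSpace ℝ (Fin d) → ℝ) : Prop where
  predictive : IsPredictiveDensity p
  equivariant : IsEquivariant p
  risk_le : ∀ q, IsPredictiveDensity q → IsEquivariant q →
    ∀ μ, wassersteinRisk f μ p ≤ wassersteinRisk f μ q

/-- `p` is a predictive density that minimizes the maximum risk among all predictive densities. -/
structure IsMinimax {d : ℕ} (f : EuclideanSpace ℝ (Fin d) → ℝ)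
    (p : EuclideanSpace ℝ (Fin d) → EuclideanSpace ℝ (Fin d) → ℝ) : Prop where
  predictive : IsPredictiveDensity p
  sup_risk_le : ∀ q, IsPredictiveDensity q →
    ⨆ μ, wassersteinRisk f μ p ≤ ⨆ μ, wassersteinRisk f μ q

end

/-! Translating both marginals of a coupling shifts `X - Y` by a constant, so `W₂²` changes only by
a term linear in the difference of means plus the squared shift
(`ofReal_le_wassersteinTwo_sq_map_add`). An equivariant predictor is a translate `Q + x` of one law
`Q`. Averaging over `x`, the linear term vanishes because `f` is centred, and the risk is at least
`W₂(P, Q)² + σ²`, with `P` the law of density `f` and `σ² = E‖z‖²`. The plug-in has risk at most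
`σ²`, so it is best, and any rival as good has `W₂(P, Q) = 0`, hence `Q = P`
(`eq_of_wassersteinTwo_sq_eq_zero`).

For minimaxity, `W₂` dominates the distance between means, so the risk of any predictor is at least
the quadratic risk of its mean `m(x)` as an estimator of the location. It remains to show that no
estimator of a location has maximum quadratic risk below `σ²` (`integral_norm_sq_le_of_risk_le`).
This is a Bayes argument with weights `exp (-ε‖u‖)`, `ε → 0`, which change so slowly under
translation that the cross term almost vanishes; only second moments of `f` are needed. -/

/-! ### Squared Wasserstein distance as an infimum of costs -/

theorem wassersteinTwo_sq_le {S : Type*} [MeasurableSpace S] [PseudoEMetricSpace S]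
    {P Q : Measure S} {γ : Measure (S × S)} (h : IsCoupling P Q γ) :
    wassersteinTwo P Q ^ 2 ≤ ∫⁻ z, edist z.1 z.2 ^ 2 ∂γ := by
  have h1 : wassersteinTwo P Q ≤ (∫⁻ z, edist z.1 z.2 ^ 2 ∂γ) ^ (1 / 2 : ℝ) := iInf₂_le γ h
  calc wassersteinTwo P Q ^ 2 ≤ ((∫⁻ z, edist z.1 z.2 ^ 2 ∂γ) ^ (1 / 2 : ℝ)) ^ 2 := by gcongr
    _ = _ := by rw [← ENNReal.rpow_mul_natCast]; norm_num

theorem le_wassersteinTwo_sq {S : Type*} [MeasurableSpace S] [PseudoEMetricSpace S]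
    {P Q : Measure S} {c : ℝ≥0∞}
    (h : ∀ γ : Measure (S × S), IsCoupling P Q γ → c ≤ ∫⁻ z, edist z.1 z.2 ^ 2 ∂γ) :
    c ≤ wassersteinTwo P Q ^ 2 := by
  have h1 : c ^ (1 / 2 : ℝ) ≤ wassersteinTwo P Q :=
    le_iInf₂ fun γ hγ => ENNReal.rpow_le_rpow (h γ hγ) (by norm_num)
  calc c = (c ^ (1 / 2 : ℝ)) ^ 2 := by rw [← ENNReal.rpow_mul_natCast]; norm_num
    _ ≤ _ := by gcongr

theorem IsCoupling.isProbabilityMeasure {S : Type*} [MeasurableSpace S] {P Q : Measure S}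
    [IsProbabilityMeasure P] {γ : Measure (S × S)} (h : IsCoupling P Q γ) :
    IsProbabilityMeasure γ := by
  refine ⟨?_⟩
  have h1 : P Set.univ = 1 := measure_univ
  rwa [← h.1, Measure.map_apply measurable_fst MeasurableSet.univ, Set.preimage_univ] at h1

set_option linter.unusedSectionVars false

/-! ### Wasserstein distance, means and translations -/

section Moments

variable {E : Type*} [NormedAddCommGroup E] [InnerProductSpace ℝ E] [MeasurableSpace E]
  [BorelSpace E] [SecondCountableTopology E] [CompleteSpace E]

theorem lintegral_edist_sq_eq {γ : Measure (E × E)} [IsFiniteMeasure γ]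
    (hD : MemLp (fun z : E × E => z.1 - z.2) 2 γ) :
    ∫⁻ z, edist z.1 z.2 ^ 2 ∂γ = ENNReal.ofReal (∫ z, ‖z.1 - z.2‖ ^ 2 ∂γ) := by
  rw [ofReal_integral_eq_lintegral_ofReal hD.integrable_norm_pow' (ae_of_all _ fun z => by positivity)]
  refine lintegral_congr fun z => ?_
  rw [edist_eq_enorm_sub, ENNReal.ofReal_pow (norm_nonneg _), ofReal_norm]

theorem memLp_two_sub_of_lintegral_ne_top {γ : Measure (E × E)}
    (h : ∫⁻ z, edist z.1 z.2 ^ 2 ∂γ ≠ ⊤) : MemLp (fun z : E × E => z.1 - z.2) 2 γ := by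
  refine ⟨by fun_prop, ?_⟩
  rw [eLpNorm_lt_top_iff_lintegral_rpow_enorm_lt_top (by norm_num) (by norm_num)]
  simpa [edist_eq_enorm_sub, lt_top_iff_ne_top] using h

theorem IsCoupling.memLp_fst {P Q : Measure E} {γ : Measure (E × E)} (h : IsCoupling P Q γ)
    (hP : MemLp id 2 P) : MemLp (fun z : E × E => z.1) 2 γ := by
  rw [← h.1] at hP
  exact hP.comp_of_map measurable_fst.aemeasurable

/-- Finite cost together with a second moment of `P` forces a second moment of `Q`, so the mean of
`Q` is a genuine one. -/
theorem IsCoupling.integral_sub {P Q : Measure E} [IsProbabilityMeasure P] {γ : Measure (E × E)}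
    (h : IsCoupling P Q γ) (hP : MemLp id 2 P) (hD : MemLp (fun z : E × E => z.1 - z.2) 2 γ) :
    ∫ z, (z.1 - z.2) ∂γ = ∫ x, x ∂P - ∫ y, y ∂Q := by
  have := h.isProbabilityMeasure
  have h1 := h.memLp_fst hP
  have h2 : MemLp (fun z : E × E => z.2) 2 γ := by
    convert h1.sub hD using 1
    ext z; simp
  rw [MeasureTheory.integral_sub (h1.integrable (by norm_num)) (h2.integrable (by norm_num))]
  congr 1
  · rw [← h.1, integral_map measurable_fst.aemeasurable (by fun_prop)]
  · rw [← h.2, integral_map measurable_snd.aemeasurable (by fun_prop)]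

theorem integral_norm_add_const_sq {Ω : Type*} [MeasurableSpace Ω] {γ : Measure Ω}
    [IsProbabilityMeasure γ] {D : Ω → E} (hD : MemLp D 2 γ) (v : E) :
    ∫ z, ‖D z + v‖ ^ 2 ∂γ = ∫ z, ‖D z‖ ^ 2 ∂γ + 2 * inner ℝ v (∫ z, D z ∂γ) + ‖v‖ ^ 2 := by
  have hi : Integrable D γ := hD.integrable (by norm_num)
  have h1 : Integrable (fun z => ‖D z‖ ^ 2) γ := hD.integrable_norm_pow'
  have h2 : Integrable (fun z => 2 * inner ℝ v (D z)) γ := (hi.const_inner v).const_mul 2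
  simp_rw [norm_add_sq_real, real_inner_comm v]
  rw [integral_add (by exact h1.add h2) (integrable_const _), integral_add h1 h2,
    integral_const_mul, integral_inner hi]
  simp

/-- The variance of `X - Y` is nonnegative under each coupling. If `Q` has no mean, its integral is
the default `0`, but then every coupling has infinite cost. -/
theorem ofReal_norm_mean_sub_sq_le_wassersteinTwo_sq {P Q : Measure E}
    [IsProbabilityMeasure P] (hP : MemLp id 2 P) :
    ENNReal.ofReal (‖∫ x, x ∂P - ∫ y, y ∂Q‖ ^ 2) ≤ wassersteinTwo P Q ^ 2 := by
  refine le_wassersteinTwo_sq fun γ hγ => ?_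
  by_cases htop : ∫⁻ z, edist z.1 z.2 ^ 2 ∂γ = ⊤
  · simp [htop]
  have := hγ.isProbabilityMeasure
  have hD := memLp_two_sub_of_lintegral_ne_top htop
  rw [lintegral_edist_sq_eq hD]
  apply ENNReal.ofReal_le_ofReal
  have h1 := integral_norm_add_const_sq hD (-(∫ x, x ∂P - ∫ y, y ∂Q))
  rw [hγ.integral_sub hP hD, inner_neg_left, real_inner_self_eq_norm_sq, norm_neg] at h1
  have h2 : 0 ≤ ∫ z : E × E, ‖z.1 - z.2 + -(∫ x, x ∂P - ∫ y, y ∂Q)‖ ^ 2 ∂γ :=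
    integral_nonneg fun z => by positivity
  linarith

/-- Undoing the shifts turns a coupling of the translates into one of `P` and `Q`; expanding the
square leaves a linear term that depends only on the means. The real lower bound `w` stands in for
`W₂²`, which may be infinite. -/
theorem ofReal_le_wassersteinTwo_sq_map_add {P Q : Measure E}
    [IsProbabilityMeasure P] (hP : MemLp id 2 P) {w : ℝ}
    (hw : ENNReal.ofReal w ≤ wassersteinTwo P Q ^ 2) (u v : E) :
    ENNReal.ofReal (w + 2 * inner ℝ (u - v) (∫ x, x ∂P - ∫ y, y ∂Q) + ‖u - v‖ ^ 2) ≤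
      wassersteinTwo (P.map (· + u)) (Q.map (· + v)) ^ 2 := by
  refine le_wassersteinTwo_sq fun γ hγ => ?_
  by_cases htop : ∫⁻ z, edist z.1 z.2 ^ 2 ∂γ = ⊤
  · simp [htop]
  have hPu : IsProbabilityMeasure (P.map (· + u)) :=
    Measure.isProbabilityMeasure_map (by fun_prop)
  have := hγ.isProbabilityMeasure
  have hD := memLp_two_sub_of_lintegral_ne_top htop
  let s : E × E → E × E := fun z => (z.1 - u, z.2 - v)
  have hs : Measurable s := by fun_prop
  have hγ' : IsCoupling P Q (γ.map s) := by
    constructor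
    · rw [Measure.map_map measurable_fst hs]
      calc γ.map (Prod.fst ∘ s) = (γ.map Prod.fst).map (· - u) :=
            (Measure.map_map (measurable_id.sub_const u) measurable_fst).symm
        _ = P := by
            rw [hγ.1, Measure.map_map (by fun_prop) (by fun_prop)]
            simp [Function.comp_def]
    · rw [Measure.map_map measurable_snd hs]
      calc γ.map (Prod.snd ∘ s) = (γ.map Prod.snd).map (· - v) :=
            (Measure.map_map (measurable_id.sub_const v) measurable_snd).symm
        _ = Q := by
            rw [hγ.2, Measure.map_map (by fun_prop) (by fun_prop)]
            simp [Function.comp_def]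
  have hγ'p := hγ'.isProbabilityMeasure
  have hD' : MemLp (fun z : E × E => z.1 - z.2) 2 (γ.map s) := by
    rw [memLp_map_measure_iff (by fun_prop) hs.aemeasurable]
    convert hD.sub (memLp_const (u - v)) using 1
    ext z; simp [s]; abel
  have hcost := wassersteinTwo_sq_le hγ'
  rw [lintegral_edist_sq_eq hD'] at hcost
  have hle : w ≤ ∫ z, ‖z.1 - z.2‖ ^ 2 ∂(γ.map s) := 
    (ENNReal.ofReal_le_ofReal_iff (integral_nonneg fun z => by positivity)).1 (hw.trans hcost)
  have h1 := integral_norm_add_const_sq hD' (u - v)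
  rw [hγ'.integral_sub hP hD', integral_map hs.aemeasurable (by fun_prop)] at h1
  have h2 : ∀ z : E × E, (s z).1 - (s z).2 + (u - v) = z.1 - z.2 := fun z => by simp only [s]; abel
  simp_rw [h2] at h1
  rw [lintegral_edist_sq_eq hD, h1]
  gcongr

theorem wassersteinTwo_sq_map_add_le (P : Measure E) [IsProbabilityMeasure P] (u v : E) :
    wassersteinTwo (P.map (· + u)) (P.map (· + v)) ^ 2 ≤ ENNReal.ofReal (‖u - v‖ ^ 2) := by
  have hs : Measurable fun x : E => (x + u, x + v) := by fun_prop
  have hγ : IsCoupling (P.map (· + u)) (P.map (· + v)) (P.map fun x => (x + u, x + v)) := by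
    constructor
    · rw [Measure.map_map measurable_fst hs]; rfl
    · rw [Measure.map_map measurable_snd hs]; rfl
  refine (wassersteinTwo_sq_le hγ).trans_eq ?_
  rw [lintegral_map (by fun_prop) hs]
  simp [edist_eq_enorm_sub, ENNReal.ofReal_pow, ofReal_norm]

/-- No optimal coupling is needed: since `x ↦ exp (i⟪x, t⟫)` is `‖t‖`-Lipschitz, every coupling's
cost controls the gap between the characteristic functions at `t`. -/
theorem eq_of_wassersteinTwo_sq_eq_zero {P Q : Measure E}
    [IsProbabilityMeasure P] [IsProbabilityMeasure Q] (h : wassersteinTwo P Q ^ 2 = 0) :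
    P = Q := by
  refine Measure.ext_of_charFun (funext fun t => ?_)
  set Δ := ‖charFun P t - charFun Q t‖ with hΔ
  -- The natural denominator is `‖t‖ ^ 2`; adding `1` avoids treating `t = 0` separately.
  suffices hb : ENNReal.ofReal (Δ ^ 2 / (1 + ‖t‖ ^ 2)) ≤ wassersteinTwo P Q ^ 2 by
    rw [h, nonpos_iff_eq_zero, ENNReal.ofReal_eq_zero,
      div_le_iff₀ (by positivity), zero_mul] at hb
    have h0 : Δ = 0 := by nlinarith
    rwa [hΔ, norm_eq_zero, sub_eq_zero] at h0
  refine le_wassersteinTwo_sq fun γ hγ => ?_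
  by_cases htop : ∫⁻ z, edist z.1 z.2 ^ 2 ∂γ = ⊤
  · simp [htop]
  have := hγ.isProbabilityMeasure
  have hD := memLp_two_sub_of_lintegral_ne_top htop
  rw [lintegral_edist_sq_eq hD]
  apply ENNReal.ofReal_le_ofReal
  have hsub : charFun P t - charFun Q t = ∫ z : E × E,
      (Complex.exp (inner ℝ z.1 t * Complex.I) - Complex.exp (inner ℝ z.2 t * Complex.I)) ∂γ := by
    rw [charFun_apply, charFun_apply, ← hγ.1, ← hγ.2,
      integral_map measurable_fst.aemeasurable (by fun_prop),
      integral_map measurable_snd.aemeasurable (by fun_prop), MeasureTheory.integral_sub]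
    · refine Integrable.of_bound (by fun_prop) 1 (ae_of_all _ fun z => ?_)
      rw [Complex.norm_exp_ofReal_mul_I]
    · refine Integrable.of_bound (by fun_prop) 1 (ae_of_all _ fun z => ?_)
      rw [Complex.norm_exp_ofReal_mul_I]
  have hle : Δ ≤ ‖t‖ * ∫ z : E × E, ‖z.1 - z.2‖ ∂γ := by
    rw [hΔ, hsub, ← integral_const_mul]
    refine norm_integral_le_of_norm_le ((hD.integrable (by norm_num)).norm.const_mul _)
      (ae_of_all _ fun z => ?_)
    have h1 : Complex.exp (inner ℝ z.1 t * Complex.I) - Complex.exp (inner ℝ z.2 t * Complex.I) =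
        Complex.exp (inner ℝ z.2 t * Complex.I) *
          (Complex.exp (Complex.I * ((inner ℝ (z.1 - z.2) t : ℝ) : ℂ)) - 1) := by
      rw [mul_sub, ← Complex.exp_add, mul_one, inner_sub_left]
      congr 2
      push_cast
      ring
    rw [h1, norm_mul, Complex.norm_exp_ofReal_mul_I, one_mul, mul_comm ‖t‖]
    exact Real.norm_exp_I_mul_ofReal_sub_one_le.trans (norm_inner_le_norm _ _)
  -- The variance of `‖X - Y‖` is nonnegative, giving `m ^ 2 ≤ E‖X - Y‖ ^ 2`.
  have hsq := integral_norm_add_const_sq hD.norm (-∫ z : E × E, ‖z.1 - z.2‖ ∂γ)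
  have h0 : 0 ≤ ∫ z : E × E, ‖‖z.1 - z.2‖ + -∫ z : E × E, ‖z.1 - z.2‖ ∂γ‖ ^ 2 ∂γ :=
    integral_nonneg fun z => by positivity
  have hm : 0 ≤ ∫ z : E × E, ‖z.1 - z.2‖ ∂γ := integral_nonneg fun z => by positivity
  simp only [norm_norm, inner_neg_left, real_inner_self_eq_norm_sq, norm_neg] at hsq
  rw [Real.norm_of_nonneg hm] at hsq
  rw [div_le_iff₀ (by positivity)]
  set m := ∫ z : E × E, ‖z.1 - z.2‖ ∂γ
  have h2 : Δ ^ 2 ≤ (‖t‖ * m) ^ 2 := by gcongr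
  nlinarith [mul_nonneg (sq_nonneg ‖t‖) (by linarith : (0 : ℝ) ≤ (∫ z : E × E, ‖z.1 - z.2‖ ^ 2 ∂γ) - m ^ 2), sq_nonneg m]

end Moments

/-! ### Lower bound for the maximum quadratic risk in a location family -/

section Smoothing

variable {E : Type*} [NormedAddCommGroup E] [InnerProductSpace ℝ E] [MeasurableSpace E]
  [BorelSpace E] [FiniteDimensional ℝ E]

theorem integrable_exp_neg_mul_norm (l : Measure E) [l.IsAddHaarMeasure] {ε : ℝ} (hε : 0 < ε) :
    Integrable (fun x : E => Real.exp (-(ε * ‖x‖))) l := by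
  set n := Module.finrank ℝ E + 1 with hn
  have h1 : Integrable (fun x : E => (1 + ‖x‖) ^ (-(n : ℝ))) l :=
    integrable_one_add_norm (by rw [hn]; push_cast; linarith)
  refine (h1.const_mul (n.factorial * Real.exp ε / ε ^ n)).mono' (by fun_prop)
    (ae_of_all _ fun x => ?_)
  have h2 := Real.pow_div_factorial_le_exp (ε * (1 + ‖x‖)) (by positivity) n
  have hx : 0 < (1 + ‖x‖) ^ n := by positivity
  rw [Real.norm_of_nonneg (Real.exp_pos _).le, Real.rpow_neg (by positivity), Real.rpow_natCast,
    Real.exp_neg, ← div_eq_mul_inv, div_div, le_div_iff₀ (by positivity),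
    inv_mul_le_iff₀ (Real.exp_pos _)]
  rw [div_le_iff₀ (by positivity), mul_pow, mul_add, mul_one, Real.exp_add] at h2
  linarith

theorem exp_neg_mul_norm_le {ε : ℝ} (hε : 0 ≤ ε) (x z : E) :
    Real.exp (-(ε * ‖x‖)) ≤ Real.exp (ε * ‖z‖) * Real.exp (-(ε * ‖x - z‖)) ∧
    Real.exp (-(ε * ‖x - z‖)) ≤ Real.exp (ε * ‖z‖) * Real.exp (-(ε * ‖x‖)) := by
  have h1 : ‖x - z‖ ≤ ‖x‖ + ‖z‖ := norm_sub_le x z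
  have h2 : ‖x‖ ≤ ‖x - z‖ + ‖z‖ := norm_le_norm_sub_add x z
  constructor <;> rw [← Real.exp_add] <;> apply Real.exp_le_exp.2 <;> nlinarith

theorem abs_exp_neg_mul_norm_sub_le {ε : ℝ} (hε : 0 ≤ ε) (x z : E) :
    |Real.exp (-(ε * ‖x - z‖)) - Real.exp (-(ε * ‖x‖))| ≤
      (Real.exp (ε * ‖z‖) - 1) * Real.exp (-(ε * ‖x‖)) := by
  obtain ⟨h1, h2⟩ := exp_neg_mul_norm_le hε x z
  have h3 : 1 ≤ Real.exp (ε * ‖z‖) := Real.one_le_exp (by positivity)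
  have h4 := Real.exp_pos (-(ε * ‖x‖))
  have h5 := Real.exp_pos (-(ε * ‖x - z‖))
  rw [abs_le]
  constructor
  -- With `t = exp (ε‖z‖)`, this uses `2 - t ≤ 1 / t`, that is `(2 - t) * t ≤ 1`.
  · have h6 : (2 - Real.exp (ε * ‖z‖)) * Real.exp (-(ε * ‖x‖)) ≤ Real.exp (-(ε * ‖x - z‖)) := by
      by_cases h7 : 2 - Real.exp (ε * ‖z‖) ≤ 0
      · exact (mul_nonpos_of_nonpos_of_nonneg h7 h4.le).trans h5.le
      · calc _ ≤ (2 - Real.exp (ε * ‖z‖)) * (Real.exp (ε * ‖z‖) * Real.exp (-(ε * ‖x - z‖))) := by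
              gcongr; linarith
          _ = ((2 - Real.exp (ε * ‖z‖)) * Real.exp (ε * ‖z‖)) * Real.exp (-(ε * ‖x - z‖)) := by ring
          _ ≤ 1 * Real.exp (-(ε * ‖x - z‖)) := by
              gcongr
              nlinarith [sq_nonneg (Real.exp (ε * ‖z‖) - 1)]
          _ = _ := one_mul _
    linarith
  · linarith

/-- The factor `Real.exp (ε * ‖z‖) - 1` tends to `0` with `ε`; the cap `2` keeps the bound
integrable against `‖z‖ ^ 2` without exponential moments. -/
theorem integral_abs_exp_neg_mul_norm_sub_le (l : Measure E) [l.IsAddHaarMeasure] {ε : ℝ}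
    (hε : 0 < ε) (z : E) :
    ∫ x, |Real.exp (-(ε * ‖x - z‖)) - Real.exp (-(ε * ‖x‖))| ∂l ≤
      min 2 (Real.exp (ε * ‖z‖) - 1) * ∫ x, Real.exp (-(ε * ‖x‖)) ∂l := by
  have h1 := integrable_exp_neg_mul_norm l hε
  have h2 := h1.comp_sub_right z
  have h3 : Integrable (fun x => |Real.exp (-(ε * ‖x - z‖)) - Real.exp (-(ε * ‖x‖))|) l :=
    (h2.sub h1).abs
  rw [min_mul_of_nonneg _ _ (integral_nonneg fun x => (Real.exp_pos _).le)]
  refine le_min ?_ ?_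
  · calc _ ≤ ∫ x, (Real.exp (-(ε * ‖x - z‖)) + Real.exp (-(ε * ‖x‖))) ∂l := by
          refine integral_mono h3 (h2.add h1) fun x => ?_
          refine (abs_sub _ _).trans_eq ?_
          rw [abs_of_pos (Real.exp_pos _), abs_of_pos (Real.exp_pos _)]
      _ = _ := by
          rw [integral_add h2 h1, integral_sub_right_eq_self (fun x => Real.exp (-(ε * ‖x‖)))]
          ring
  · rw [← integral_const_mul]
    exact integral_mono h3 (h1.const_mul _) fun x => abs_exp_neg_mul_norm_sub_le hε.le x z

/-- The Bayes inequality for the prior with density proportional to `exp (-ε ‖x‖)`. -/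
theorem integral_norm_sq_le_add_of_risk_le {ν l : Measure E} [IsProbabilityMeasure ν]
    [l.IsAddHaarMeasure] (hν : MemLp id 2 ν) (hν0 : ∫ z, z ∂ν = 0) {a : E → E} (ha : Measurable a)
    {S : ℝ} (hS0 : 0 ≤ S)
    (hS : ∀ u, ∫⁻ z, ENNReal.ofReal (‖a (z + u) + z‖ ^ 2) ∂ν ≤ ENNReal.ofReal S)
    {ε κ : ℝ} (hε : 0 < ε) (hε1 : ε ≤ 1) (hκ : κ = ∫ z, Real.exp (-‖z‖) ∂ν) (hκ0 : 0 < κ) :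
    ∫ z, ‖z‖ ^ 2 ∂ν ≤
      S + (1 + κ) / κ * ∫ z, ‖z‖ ^ 2 * min 2 (Real.exp (ε * ‖z‖) - 1) ∂ν := by
  set p : E → ℝ := fun x => Real.exp (-(ε * ‖x‖)) with hp
  have hp0 : ∀ x, 0 < p x := fun x => Real.exp_pos _
  have hpm : Measurable p := by fun_prop
  have hpi : Integrable p l := integrable_exp_neg_mul_norm l hε
  set c := ∫ x, p x ∂l with hc
  have hc0 : 0 < c := integral_exp_pos hpi
  have hsq : Integrable (fun z : E => ‖z‖ ^ 2) ν := hν.integrable_norm_pow'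
  -- In the pair `w = (z, x)`, `x = z + u` is the observation, so `p (x - z)` is the prior weight of
  -- `u`. `T` is the Bayes risk integrand, `Q` and `A` its square terms, `D` the cross term with `p
  -- x` in place of `p (x - z)`, and `V` measures that replacement.
  set T : E × E → ℝ := fun w => ‖a w.2 + w.1‖ ^ 2 * p (w.2 - w.1) with hTdef
  set Q : E × E → ℝ := fun w => ‖w.1‖ ^ 2 * p (w.2 - w.1) with hQdef
  set A : E × E → ℝ := fun w => ‖a w.2‖ ^ 2 * p (w.2 - w.1) with hAdef
  set B : E × E → ℝ := fun w => 1 * (‖a w.2‖ ^ 2 * p w.2) with hBdef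
  set D : E × E → ℝ := fun w => inner ℝ (a w.2) w.1 * p w.2 with hDdef
  set V : E × E → ℝ := fun w => ‖w.1‖ ^ 2 * |p (w.2 - w.1) - p w.2| with hVdef
  have hTm : Measurable T := by fun_prop
  have hTl : ∫⁻ w, ENNReal.ofReal (T w) ∂(ν.prod l) ≤ ENNReal.ofReal (S * c) := by
    rw [lintegral_prod _ (by fun_prop)]
    calc ∫⁻ z, ∫⁻ x, ENNReal.ofReal (T (z, x)) ∂l ∂ν
        = ∫⁻ z, ∫⁻ u, ENNReal.ofReal (p u) * ENNReal.ofReal (‖a (z + u) + z‖ ^ 2) ∂l ∂ν := by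
          refine lintegral_congr fun z => ?_
          rw [← lintegral_add_left_eq_self _ z]
          refine lintegral_congr fun u => ?_
          rw [← ENNReal.ofReal_mul (hp0 u).le, mul_comm]
          simp [hTdef]
      _ = ∫⁻ u, ∫⁻ z, ENNReal.ofReal (p u) * ENNReal.ofReal (‖a (z + u) + z‖ ^ 2) ∂ν ∂l :=
          lintegral_lintegral_swap (by fun_prop)
      _ ≤ ∫⁻ u, ENNReal.ofReal (p u) * ENNReal.ofReal S ∂l := by
          refine lintegral_mono fun u => ?_
          rw [lintegral_const_mul _ (by fun_prop)]
          gcongr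
          exact hS u
      _ = ENNReal.ofReal (S * c) := by
          rw [lintegral_mul_const _ (by fun_prop), mul_comm, ENNReal.ofReal_mul hS0,
            ofReal_integral_eq_lintegral_ofReal hpi (ae_of_all _ fun x => (hp0 x).le)]
  have hT0 : ∀ w, 0 ≤ T w := fun w => mul_nonneg (sq_nonneg _) (hp0 _).le
  have hTi : Integrable T (ν.prod l) :=
    ⟨hTm.aestronglyMeasurable, by
      rw [hasFiniteIntegral_iff_ofReal (ae_of_all _ hT0)]
      exact hTl.trans_lt ENNReal.ofReal_lt_top⟩
  have hTle : ∫ w, T w ∂(ν.prod l) ≤ S * c := by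
    rw [← ofReal_integral_eq_lintegral_ofReal hTi (ae_of_all _ hT0)] at hTl
    exact (ENNReal.ofReal_le_ofReal_iff (by positivity)).1 hTl
  have hQi : Integrable Q (ν.prod l) := by
    rw [← (measurePreserving_prod_add ν l).integrable_comp_emb
      (MeasurableEquiv.shearAddRight E).measurableEmbedding]
    refine (hsq.mul_prod hpi).congr (ae_of_all _ fun w => ?_)
    simp [hQdef]
  have hQint : ∫ w, Q w ∂(ν.prod l) = (∫ z, ‖z‖ ^ 2 ∂ν) * c := by
    rw [integral_prod _ hQi, ← integral_mul_const]
    refine integral_congr_ae (ae_of_all _ fun z => ?_)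
    simp only [hQdef]
    rw [integral_const_mul, integral_sub_right_eq_self p]
  have hAi : Integrable A (ν.prod l) := by
    refine ((hTi.add hQi).const_mul 2).mono' (by fun_prop) (ae_of_all _ fun w => ?_)
    have h1 : ‖a w.2‖ ^ 2 ≤ 2 * (‖a w.2 + w.1‖ ^ 2 + ‖w.1‖ ^ 2) := by
      have h2 : ‖a w.2‖ ≤ ‖a w.2 + w.1‖ + ‖w.1‖ := by
        simpa using norm_sub_le (a w.2 + w.1) w.1
      nlinarith [sq_nonneg (‖a w.2 + w.1‖ - ‖w.1‖), norm_nonneg (a w.2)]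
    rw [Real.norm_of_nonneg (mul_nonneg (sq_nonneg _) (hp0 _).le)]
    calc _ ≤ 2 * (‖a w.2 + w.1‖ ^ 2 + ‖w.1‖ ^ 2) * p (w.2 - w.1) := by
          gcongr
      _ = _ := by simp [hTdef, hQdef]; ring
  have hBx : Integrable (fun x => ‖a x‖ ^ 2 * p x) l := by
    -- One slice of `A` is enough, since `p x` and `p (x - z)` are comparable for fixed `z`.
    obtain ⟨z, hz⟩ := hAi.prod_right_ae.exists
    refine (hz.const_mul (Real.exp (ε * ‖z‖))).mono' (by fun_prop) (ae_of_all _ fun x => ?_)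
    rw [Real.norm_of_nonneg (mul_nonneg (sq_nonneg _) (hp0 _).le)]
    simp only [hAdef]
    nlinarith [mul_le_mul_of_nonneg_left (exp_neg_mul_norm_le hε.le x z).1 (sq_nonneg ‖a x‖)]
  have hBi : Integrable B (ν.prod l) := (integrable_const (1 : ℝ)).mul_prod hBx
  have hBint : ∫ w, B w ∂(ν.prod l) = ∫ x, ‖a x‖ ^ 2 * p x ∂l := by
    rw [integral_prod _ hBi]
    simp [hBdef]
  have hκi : Integrable (fun z : E => Real.exp (-‖z‖)) ν := by
    refine Integrable.of_bound (by fun_prop) 1 (ae_of_all _ fun z => ?_)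
    rw [Real.norm_of_nonneg (Real.exp_pos _).le, Real.exp_le_one_iff]
    simp
  have hAB : κ * ∫ w, B w ∂(ν.prod l) ≤ ∫ w, A w ∂(ν.prod l) := by
    have h1 : Integrable (fun w : E × E => Real.exp (-‖w.1‖) * (‖a w.2‖ ^ 2 * p w.2))
      (ν.prod l) := hκi.mul_prod hBx
    have h2 : κ * ∫ w, B w ∂(ν.prod l) =
        ∫ w : E × E, Real.exp (-‖w.1‖) * (‖a w.2‖ ^ 2 * p w.2) ∂(ν.prod l) := by
      rw [integral_prod_mul (fun z : E => Real.exp (-‖z‖)) (fun x => ‖a x‖ ^ 2 * p x), hκ, hBint]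
    rw [h2]
    refine integral_mono h1 hAi fun w => ?_
    have h3 := (exp_neg_mul_norm_le hε.le w.2 w.1).1
    -- Here `ε ≤ 1` makes the constant `κ` independent of `ε`.
    have h4 : Real.exp (-‖w.1‖) * p w.2 ≤ p (w.2 - w.1) := by
      calc Real.exp (-‖w.1‖) * p w.2
          ≤ Real.exp (-(ε * ‖w.1‖)) * (Real.exp (ε * ‖w.1‖) * p (w.2 - w.1)) := by
            gcongr
            nlinarith [norm_nonneg w.1]
        _ = p (w.2 - w.1) := by rw [← mul_assoc, ← Real.exp_add]; simp
    simp only [hAdef]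
    nlinarith [mul_le_mul_of_nonneg_left h4 (sq_nonneg ‖a w.2‖)]
  have hDi : Integrable D (ν.prod l) := by
    have h1 : Integrable (fun w : E × E => ‖w.1‖ * (p w.2 + ‖a w.2‖ ^ 2 * p w.2)) (ν.prod l) :=
      (hν.integrable (by norm_num)).norm.mul_prod (hpi.add hBx)
    refine h1.mono' (by fun_prop) (ae_of_all _ fun w => ?_)
    simp only [hDdef]
    rw [norm_mul, Real.norm_of_nonneg (hp0 _).le]
    have h2 : ‖inner ℝ (a w.2) w.1‖ ≤ ‖a w.2‖ * ‖w.1‖ := norm_inner_le_norm _ _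
    have h3 : ‖a w.2‖ ≤ 1 + ‖a w.2‖ ^ 2 := by nlinarith [sq_nonneg (‖a w.2‖ - 1)]
    calc _ ≤ (‖a w.2‖ * ‖w.1‖) * p w.2 := by gcongr
      _ ≤ ((1 + ‖a w.2‖ ^ 2) * ‖w.1‖) * p w.2 := by gcongr
      _ = _ := by ring
  have hDint : ∫ w, D w ∂(ν.prod l) = 0 := by
    -- Integrating over `z` first kills the cross term, because `ν` is centred.
    rw [integral_prod_symm _ hDi]
    refine integral_eq_zero_of_ae (ae_of_all _ fun x => ?_)
    have h1 : ∫ z : E, inner ℝ (a x) z ∂ν = 0 := by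
      rw [integral_inner (f := fun z : E => z) (hν.integrable (by norm_num)), hν0, inner_zero_right]
    simp [hDdef, integral_mul_const, h1]
  have hVi : Integrable V (ν.prod l) := by
    refine (hQi.add (hsq.mul_prod hpi)).mono' (by fun_prop) (ae_of_all _ fun w => ?_)
    rw [Real.norm_of_nonneg (by positivity)]
    have h1 : |p (w.2 - w.1) - p w.2| ≤ p (w.2 - w.1) + p w.2 := by
      rw [abs_le]; constructor <;> linarith [hp0 (w.2 - w.1), hp0 w.2]
    simp only [hVdef, hQdef, Pi.add_apply]
    nlinarith [mul_le_mul_of_nonneg_left h1 (sq_nonneg ‖w.1‖)]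
  have hVle : ∫ w, V w ∂(ν.prod l) ≤
      (∫ z, ‖z‖ ^ 2 * min 2 (Real.exp (ε * ‖z‖) - 1) ∂ν) * c := by
    rw [integral_prod _ hVi, ← integral_mul_const]
    refine integral_mono hVi.integral_prod_left ?_ fun z => ?_
    · refine ((hsq.mul_const 2).mono' (by fun_prop) (ae_of_all _ fun z => ?_)).mul_const c
      have h1 : 1 ≤ Real.exp (ε * ‖z‖) := Real.one_le_exp (by positivity)
      rw [Real.norm_of_nonneg (mul_nonneg (sq_nonneg _) (le_min (by norm_num) (by linarith)))]
      gcongr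
      exact min_le_left _ _
    · simp only [hVdef]
      rw [integral_const_mul, mul_assoc]
      gcongr
      exact integral_abs_exp_neg_mul_norm_sub_le l hε z
  -- Chosen so that `κ ∫ B ≤ ∫ A` yields `η (∫ A + ∫ B) ≤ ∫ A`: the Young error in `‖a‖ ^ 2` is
  -- absorbed by `A`, whatever the size of `a`.
  set η := κ / (1 + κ) with hη
  have hη0 : 0 < η := by positivity
  have hpt : ∀ w, Q w + A w + 2 * D w ≤ T w + η * (A w + B w) + η⁻¹ * V w := by
    intro w
    simp only [hQdef, hAdef, hDdef, hTdef, hBdef, hVdef]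
    have hn := norm_add_sq_real (a w.2) w.1
    have hq := hp0 w.2
    have hr := hp0 (w.2 - w.1)
    have hcs := abs_real_inner_le_norm (a w.2) w.1
    set i := inner ℝ (a w.2) w.1
    set α := ‖a w.2‖
    set β := ‖w.1‖
    set r := p (w.2 - w.1)
    set q := p w.2
    have h1 : |r - q| ≤ r + q := by rw [abs_le]; constructor <;> linarith
    have h2 : -(2 * (i * (r - q))) ≤ 2 * (α * β) * |r - q| := by
      calc -(2 * (i * (r - q))) ≤ |2 * (i * (r - q))| := neg_le_abs _
        _ = 2 * |i| * |r - q| := by rw [abs_mul, abs_mul]; simp; ring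
        _ ≤ _ := by gcongr
    have h3 : 2 * (α * β) ≤ η * α ^ 2 + η⁻¹ * β ^ 2 := by
      have h4 : 0 ≤ η⁻¹ * (η * α - β) ^ 2 := by positivity
      have h5 : η⁻¹ * (η * α - β) ^ 2 = η * α ^ 2 + η⁻¹ * β ^ 2 - 2 * (α * β) := by
        field_simp; ring
      linarith
    have h6 := mul_le_mul_of_nonneg_right h3 (abs_nonneg (r - q))
    have h7 := mul_le_mul_of_nonneg_left h1 (by positivity : 0 ≤ η * α ^ 2)
    rw [hn]
    linarith
  have hint : ∫ w, (Q w + A w + 2 * D w) ∂(ν.prod l) ≤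
      ∫ w, (T w + η * (A w + B w) + η⁻¹ * V w) ∂(ν.prod l) :=
    integral_mono ((hQi.add hAi).add (hDi.const_mul 2))
      ((hTi.add ((hAi.add hBi).const_mul η)).add (hVi.const_mul η⁻¹)) hpt
  rw [integral_add (by exact hQi.add hAi) (hDi.const_mul 2), integral_add hQi hAi,
    integral_const_mul, integral_add (by exact hTi.add ((hAi.add hBi).const_mul η))
      (hVi.const_mul η⁻¹), integral_add hTi (by exact (hAi.add hBi).const_mul η),
    integral_const_mul, integral_const_mul, integral_add hAi hBi, hDint, hQint] at hint
  have hηAB : η * ((∫ w, A w ∂(ν.prod l)) + ∫ w, B w ∂(ν.prod l)) ≤ ∫ w, A w ∂(ν.prod l) := by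
    rw [hη, div_mul_eq_mul_div, div_le_iff₀ (by positivity)]
    linarith
  have hηV := mul_le_mul_of_nonneg_left hVle (inv_nonneg.2 hη0.le)
  have hηinv : η⁻¹ = (1 + κ) / κ := by rw [hη, inv_div]
  rw [← hηinv]
  refine le_of_mul_le_mul_right ?_ hc0
  linarith

theorem integral_norm_sq_le_of_risk_le {ν : Measure E} [IsProbabilityMeasure ν]
    (hν : MemLp id 2 ν) (hν0 : ∫ z, z ∂ν = 0) {a : E → E} (ha : Measurable a)
    {S : ℝ} (hS0 : 0 ≤ S)
    (hS : ∀ u, ∫⁻ z, ENNReal.ofReal (‖a (z + u) + z‖ ^ 2) ∂ν ≤ ENNReal.ofReal S) :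
    ∫ z, ‖z‖ ^ 2 ∂ν ≤ S := by
  have hsq : Integrable (fun z : E => ‖z‖ ^ 2) ν := hν.integrable_norm_pow'
  have hκi : Integrable (fun z : E => Real.exp (-‖z‖)) ν := by
    refine Integrable.of_bound (by fun_prop) 1 (ae_of_all _ fun z => ?_)
    rw [Real.norm_of_nonneg (Real.exp_pos _).le, Real.exp_le_one_iff]
    simp
  have hκ0 : 0 < ∫ z, Real.exp (-‖z‖) ∂ν := integral_exp_pos hκi
  have hlim : Filter.Tendsto
      (fun ε : ℝ => ∫ z, ‖z‖ ^ 2 * min 2 (Real.exp (ε * ‖z‖) - 1) ∂ν)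
      (nhdsWithin 0 (Set.Ioi 0)) (nhds (∫ _ : E, (0 : ℝ) ∂ν)) := by
    refine tendsto_integral_filter_of_dominated_convergence (fun z => ‖z‖ ^ 2 * 2)
      (Filter.Eventually.of_forall fun ε => by fun_prop) ?_ (hsq.mul_const 2) ?_
    · filter_upwards [self_mem_nhdsWithin] with ε hε
      refine ae_of_all _ fun z => ?_
      have h1 : 1 ≤ Real.exp (ε * ‖z‖) :=
        Real.one_le_exp (mul_nonneg (Set.mem_Ioi.1 hε).le (norm_nonneg z))
      rw [Real.norm_of_nonneg (mul_nonneg (sq_nonneg _) (le_min (by norm_num) (by linarith)))]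
      gcongr
      exact min_le_left _ _
    · refine ae_of_all _ fun z => tendsto_nhdsWithin_of_tendsto_nhds ?_
      have h1 : Continuous fun ε : ℝ => ‖z‖ ^ 2 * min 2 (Real.exp (ε * ‖z‖) - 1) := by fun_prop
      simpa using h1.tendsto 0
  have hlim2 := (hlim.const_mul ((1 + ∫ z, Real.exp (-‖z‖) ∂ν) / ∫ z, Real.exp (-‖z‖) ∂ν)).const_add S
  rw [integral_zero, mul_zero, add_zero] at hlim2
  refine ge_of_tendsto hlim2 ?_
  filter_upwards [Ioc_mem_nhdsGT (zero_lt_one' ℝ)] with ε hε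
  -- Any Haar measure serves; the bound does not involve it.
  exact integral_norm_sq_le_add_of_risk_le (l := (stdOrthonormalBasis ℝ E).toBasis.addHaar)
    hν hν0 ha hS0 hS hε.1 hε.2 rfl hκ0

end Smoothing

/-- Needed for a signed integrand: the linear term in the translation formula can make the lower
bound on `W₂²` negative. -/
theorem ofReal_integral_le_lintegral_ofReal {α : Type*} [MeasurableSpace α] {μ : Measure α}
    {h : α → ℝ} (hh : Integrable h μ) :
    ENNReal.ofReal (∫ x, h x ∂μ) ≤ ∫⁻ x, ENNReal.ofReal (h x) ∂μ := by
  rw [integral_eq_lintegral_pos_part_sub_lintegral_neg_part hh]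
  exact (ENNReal.ofReal_le_ofReal (sub_le_self _ ENNReal.toReal_nonneg)).trans
    ENNReal.ofReal_toReal_le

/-! ### Predictive densities and their risk -/

section Prediction

variable {d : ℕ}

theorem isProbabilityMeasure_distOf {g : EuclideanSpace ℝ (Fin d) → ℝ} (hg0 : ∀ z, 0 ≤ g z)
    (hg1 : ∫ z, g z = 1) : IsProbabilityMeasure (distOf g) := by
  have hi : Integrable g := by
    by_contra h
    simp [integral_undef h] at hg1
  refine ⟨?_⟩
  rw [distOf, withDensity_apply _ MeasurableSet.univ, Measure.restrict_univ,
    ← ofReal_integral_eq_lintegral_ofReal hi (ae_of_all _ hg0), hg1, ENNReal.ofReal_one]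

theorem integral_distOf {F : Type*} [NormedAddCommGroup F] [NormedSpace ℝ F]
    {g : EuclideanSpace ℝ (Fin d) → ℝ} (hg : Measurable g) (hg0 : ∀ z, 0 ≤ g z)
    (h : EuclideanSpace ℝ (Fin d) → F) : ∫ z, h z ∂(distOf g) = ∫ z, g z • h z := by
  rw [distOf, integral_withDensity_eq_integral_toReal_smul (by fun_prop)
    (ae_of_all _ fun _ => ENNReal.ofReal_lt_top)]
  simp [ENNReal.toReal_ofReal, hg0]

theorem memLp_id_distOf {g : EuclideanSpace ℝ (Fin d) → ℝ} (hg : Measurable g)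
    (hg0 : ∀ z, 0 ≤ g z) (hg2 : Integrable fun z => ‖z‖ ^ 2 * g z) : MemLp id 2 (distOf g) := by
  rw [memLp_two_iff_integrable_sq_norm (by fun_prop), distOf,
    integrable_withDensity_iff (by fun_prop) (ae_of_all _ fun _ => ENNReal.ofReal_lt_top)]
  simpa [ENNReal.toReal_ofReal, hg0] using hg2

theorem distOf_locDensity (g : EuclideanSpace ℝ (Fin d) → ℝ) (u : EuclideanSpace ℝ (Fin d)) :
    distOf (locDensity g u) = (distOf g).map (· + u) := by
  ext s hs
  have hs' : MeasurableSet ((· + u) ⁻¹' s) := (measurable_id.add_const u) hs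
  rw [Measure.map_apply (by fun_prop) hs, distOf, distOf, withDensity_apply _ hs,
    withDensity_apply _ hs', ← lintegral_indicator hs, ← lintegral_indicator hs',
    ← lintegral_add_right_eq_self _ u]
  refine lintegral_congr fun x => ?_
  simp [Set.indicator, locDensity]
  rfl

theorem ae_eq_of_distOf_eq {g h : EuclideanSpace ℝ (Fin d) → ℝ} (hg : Measurable g)
    (hh : Measurable h) (hg0 : ∀ z, 0 ≤ g z) (hh0 : ∀ z, 0 ≤ h z) (hh1 : ∫ z, h z = 1)
    (heq : distOf g = distOf h) : g =ᵐ[volume] h := by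
  have hp := isProbabilityMeasure_distOf hh0 hh1
  have h1 : ∫⁻ z, ENNReal.ofReal (g z) ≠ ⊤ := by
    rw [← setLIntegral_univ, ← withDensity_apply _ MeasurableSet.univ]
    change distOf g Set.univ ≠ ⊤
    rw [heq]
    exact measure_ne_top _ _
  have h2 := (withDensity_eq_iff (by fun_prop) (by fun_prop) h1).1 heq
  filter_upwards [h2] with z hz
  rwa [ENNReal.ofReal_eq_ofReal_iff (hg0 z) (hh0 z)] at hz

theorem IsPredictiveDensity.measurable_apply
    {q : EuclideanSpace ℝ (Fin d) → EuclideanSpace ℝ (Fin d) → ℝ} (hq : IsPredictiveDensity q)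
    (x : EuclideanSpace ℝ (Fin d)) : Measurable (q x) :=
  hq.measurable.comp measurable_prodMk_left

theorem IsPredictiveDensity.isProbabilityMeasure
    {q : EuclideanSpace ℝ (Fin d) → EuclideanSpace ℝ (Fin d) → ℝ} (hq : IsPredictiveDensity q)
    (x : EuclideanSpace ℝ (Fin d)) : IsProbabilityMeasure (distOf (q x)) :=
  isProbabilityMeasure_distOf (hq.nonneg x) (hq.integral_eq_one x)

theorem IsEquivariant.distOf_eq_map
    {q : EuclideanSpace ℝ (Fin d) → EuclideanSpace ℝ (Fin d) → ℝ} (hq : IsEquivariant q)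
    (x : EuclideanSpace ℝ (Fin d)) : distOf (q x) = (distOf (q 0)).map (· + x) := by
  rw [← distOf_locDensity]
  refine withDensity_congr_ae ?_
  have h1 := (measurePreserving_sub_right volume x).quasiMeasurePreserving.ae (hq x 0)
  filter_upwards [h1] with y hy
  simp only [zero_add, sub_add_cancel] at hy
  rw [hy, locDensity]

theorem isPredictiveDensity_plugIn_id {f : EuclideanSpace ℝ (Fin d) → ℝ} (hf : Measurable f)
    (hf0 : ∀ z, 0 ≤ f z) (hf1 : ∫ z, f z = 1) : IsPredictiveDensity (plugIn f fun x => x) where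
  measurable := hf.comp (measurable_snd.sub measurable_fst)
  nonneg x y := hf0 _
  integral_eq_one x := by
    simp only [plugIn, locDensity]
    rwa [integral_sub_right_eq_self f]

theorem isEquivariant_plugIn_id (f : EuclideanSpace ℝ (Fin d) → ℝ) :
    IsEquivariant (plugIn f fun x => x) := fun c x => ae_of_all _ fun y => by
  simp [plugIn, locDensity]

/-- Two translates of one law are coupled by adding both shifts to the same variable. -/
theorem wassersteinRisk_plugIn_id_le {f : EuclideanSpace ℝ (Fin d) → ℝ} (hf : Measurable f)
    (hf0 : ∀ z, 0 ≤ f z) (hf1 : ∫ z, f z = 1) (hf2 : Integrable fun z => ‖z‖ ^ 2 * f z)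
    (u : EuclideanSpace ℝ (Fin d)) :
    wassersteinRisk f u (plugIn f fun x => x) ≤ ENNReal.ofReal (∫ z, ‖z‖ ^ 2 ∂(distOf f)) := by
  have hp := isProbabilityMeasure_distOf hf0 hf1
  have hL := memLp_id_distOf hf hf0 hf2
  calc wassersteinRisk f u (plugIn f fun x => x)
      ≤ ∫⁻ x, ENNReal.ofReal (‖u - x‖ ^ 2) ∂(distOf (locDensity f u)) := by
        refine lintegral_mono fun x => ?_
        change wassersteinTwo (distOf (locDensity f u)) (distOf (locDensity f x)) ^ 2 ≤ _
        rw [distOf_locDensity, distOf_locDensity]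
        exact wassersteinTwo_sq_map_add_le _ u x
    _ = ∫⁻ z, ENNReal.ofReal (‖z‖ ^ 2) ∂(distOf f) := by
        rw [distOf_locDensity, lintegral_map (by fun_prop) (by fun_prop)]
        simp
    _ = _ := (ofReal_integral_eq_lintegral_ofReal hL.integrable_norm_pow'
        (ae_of_all _ fun z => sq_nonneg ‖z‖)).symm

theorem le_wassersteinRisk_of_isEquivariant {f : EuclideanSpace ℝ (Fin d) → ℝ}
    (hf : Measurable f) (hf0 : ∀ z, 0 ≤ f z) (hf1 : ∫ z, f z = 1) (hfm : ∫ z, f z • z = 0)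
    (hf2 : Integrable fun z => ‖z‖ ^ 2 * f z)
    {q : EuclideanSpace ℝ (Fin d) → EuclideanSpace ℝ (Fin d) → ℝ} (hqe : IsEquivariant q)
    {w : ℝ} (hw : ENNReal.ofReal w ≤ wassersteinTwo (distOf f) (distOf (q 0)) ^ 2)
    (u : EuclideanSpace ℝ (Fin d)) :
    ENNReal.ofReal (w + ∫ z, ‖z‖ ^ 2 ∂(distOf f)) ≤ wassersteinRisk f u q := by
  have hp := isProbabilityMeasure_distOf hf0 hf1
  have hL := memLp_id_distOf hf hf0 hf2
  have hmean : ∫ z, z ∂(distOf f) = 0 := by rw [integral_distOf hf hf0, hfm]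
  set v := ∫ x, x ∂(distOf f) - ∫ y, y ∂(distOf (q 0))
  have hi1 : Integrable (fun z : EuclideanSpace ℝ (Fin d) => 2 * inner ℝ (-z) v) (distOf f) :=
    ((hL.integrable (by norm_num)).neg.inner_const v).const_mul 2
  have hi2 : Integrable (fun z : EuclideanSpace ℝ (Fin d) => ‖z‖ ^ 2) (distOf f) :=
    hL.integrable_norm_pow'
  have hval : ∫ z, (w + 2 * inner ℝ (-z) v + ‖z‖ ^ 2) ∂(distOf f) =
      w + ∫ z, ‖z‖ ^ 2 ∂(distOf f) := by
    have h1 : ∫ z : EuclideanSpace ℝ (Fin d), inner ℝ (-z) v ∂(distOf f) = 0 := by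
      simp_rw [inner_neg_left, integral_neg, real_inner_comm v]
      rw [integral_inner (f := fun z => z) (hL.integrable (by norm_num)), hmean, inner_zero_right,
        neg_zero]
    rw [integral_add (by exact (integrable_const w).add hi1) hi2,
      integral_add (integrable_const w) hi1, integral_const_mul, h1]
    simp
  calc ENNReal.ofReal (w + ∫ z, ‖z‖ ^ 2 ∂(distOf f))
      ≤ ∫⁻ z, ENNReal.ofReal (w + 2 * inner ℝ (-z) v + ‖z‖ ^ 2) ∂(distOf f) := by
        rw [← hval]
        exact ofReal_integral_le_lintegral_ofReal
          (((integrable_const w).add hi1).add hi2)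
    _ = ∫⁻ x, ENNReal.ofReal (w + 2 * inner ℝ (u - x) v + ‖u - x‖ ^ 2)
          ∂(distOf (locDensity f u)) := by
        rw [distOf_locDensity, lintegral_map (by fun_prop) (by fun_prop)]
        simp
    _ ≤ wassersteinRisk f u q := by
        refine lintegral_mono fun x => ?_
        rw [hqe.distOf_eq_map x, distOf_locDensity]
        exact ofReal_le_wassersteinTwo_sq_map_add hL hw u x

theorem le_iSup_wassersteinRisk {f : EuclideanSpace ℝ (Fin d) → ℝ}
    (hf : Measurable f) (hf0 : ∀ z, 0 ≤ f z) (hf1 : ∫ z, f z = 1) (hfm : ∫ z, f z • z = 0)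
    (hf2 : Integrable fun z => ‖z‖ ^ 2 * f z)
    {q : EuclideanSpace ℝ (Fin d) → EuclideanSpace ℝ (Fin d) → ℝ} (hq : IsPredictiveDensity q) :
    ENNReal.ofReal (∫ z, ‖z‖ ^ 2 ∂(distOf f)) ≤ ⨆ u, wassersteinRisk f u q := by
  have hp := isProbabilityMeasure_distOf hf0 hf1
  have hL := memLp_id_distOf hf hf0 hf2
  have hmean : ∫ z, z ∂(distOf f) = 0 := by rw [integral_distOf hf hf0, hfm]
  by_cases htop : ⨆ u, wassersteinRisk f u q = ⊤
  · simp [htop]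
  obtain ⟨m, hmdef⟩ : ∃ m : EuclideanSpace ℝ (Fin d) → EuclideanSpace ℝ (Fin d),
      m = fun x => ∫ y, y ∂(distOf (q x)) := ⟨_, rfl⟩
  have hm : Measurable m := by
    have h1 : m = fun x => ∫ y, q x y • y :=
      hmdef.trans <| funext fun x => integral_distOf (hq.measurable_apply x) (hq.nonneg x) _
    have h2 : StronglyMeasurable fun w : EuclideanSpace ℝ (Fin d) × EuclideanSpace ℝ (Fin d) =>
        q w.1 w.2 • w.2 := (hq.measurable.smul measurable_snd).stronglyMeasurable
    rw [h1]
    exact h2.integral_prod_right'.measurable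
  rw [← ENNReal.ofReal_toReal htop]
  -- With `a` the correction of the mean `m` to the usual estimator, `a (z + u) + z` is the
  -- estimation error `m x - u` at `x = z + u`.
  refine ENNReal.ofReal_le_ofReal (integral_norm_sq_le_of_risk_le hL hmean
    (a := fun x => m x - x)
    (hm.sub measurable_id) ENNReal.toReal_nonneg fun u => ?_)
  rw [ENNReal.ofReal_toReal htop]
  calc ∫⁻ z, ENNReal.ofReal (‖m (z + u) - (z + u) + z‖ ^ 2) ∂(distOf f)
      = ∫⁻ x, ENNReal.ofReal (‖u - m x‖ ^ 2) ∂(distOf (locDensity f u)) := by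
        rw [distOf_locDensity, lintegral_map (by fun_prop) (by fun_prop)]
        refine lintegral_congr fun z => ?_
        rw [norm_sub_rev]
        congr 3
        abel
    _ ≤ wassersteinRisk f u q := by
        refine lintegral_mono fun x => ?_
        have hpu : IsProbabilityMeasure (distOf (locDensity f u)) := by
          rw [distOf_locDensity]
          exact Measure.isProbabilityMeasure_map (by fun_prop)
        have hLu : MemLp id 2 (distOf (locDensity f u)) := by
          rw [distOf_locDensity, memLp_map_measure_iff (by fun_prop) (by fun_prop)]
          exact hL.add (memLp_const u)
        have hmu : ∫ y, y ∂(distOf (locDensity f u)) = u := by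
          rw [distOf_locDensity, integral_map (by fun_prop) (by fun_prop),
            integral_add (f := fun x => x) (hL.integrable (by norm_num)) (integrable_const u),
            hmean]
          simp
        simpa only [hmu, hmdef] using
          ofReal_norm_mean_sub_sq_le_wassersteinTwo_sq (Q := distOf (q x)) hLu
    _ ≤ _ := le_iSup (fun u => wassersteinRisk f u q) u

theorem IsBestEquivariant.ae_eq_plugIn_id {f : EuclideanSpace ℝ (Fin d) → ℝ}
    (hf : Measurable f) (hf0 : ∀ z, 0 ≤ f z) (hf1 : ∫ z, f z = 1) (hfm : ∫ z, f z • z = 0)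
    (hf2 : Integrable fun z => ‖z‖ ^ 2 * f z)
    {q : EuclideanSpace ℝ (Fin d) → EuclideanSpace ℝ (Fin d) → ℝ} (hq : IsBestEquivariant f q)
    (x : EuclideanSpace ℝ (Fin d)) : q x =ᵐ[volume] plugIn f (fun x => x) x := by
  have hp := isProbabilityMeasure_distOf hf0 hf1
  have hpq := hq.predictive.isProbabilityMeasure 0
  have hplug := isPredictiveDensity_plugIn_id hf hf0 hf1
  have hσ : 0 ≤ ∫ z, ‖z‖ ^ 2 ∂(distOf f) := integral_nonneg fun z => sq_nonneg _
  have hzero : wassersteinTwo (distOf f) (distOf (q 0)) ^ 2 = 0 := by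
    by_contra hne
    -- A finite `w` is taken below `W₂²`, which could be `⊤`; any positive excess over `σ²`
    -- contradicts the plug-in bound.
    obtain ⟨w, hw0, hw⟩ := ENNReal.lt_iff_exists_nnreal_btwn.1 (pos_iff_ne_zero.2 hne)
    have h1 := le_wassersteinRisk_of_isEquivariant hf hf0 hf1 hfm hf2 hq.equivariant
      (w := w) (by simpa using hw.le) 0
    have h2 := h1.trans ((hq.risk_le _ hplug (isEquivariant_plugIn_id f) 0).trans
      (wassersteinRisk_plugIn_id_le hf hf0 hf1 hf2 0))
    rw [ENNReal.ofReal_le_ofReal_iff hσ] at h2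
    have h3 : (0 : ℝ) < w := by simpa using hw0
    linarith
  refine ae_eq_of_distOf_eq (hq.predictive.measurable_apply x) (hplug.measurable_apply x)
    (hq.predictive.nonneg x) (hplug.nonneg x) (hplug.integral_eq_one x) ?_
  rw [hq.equivariant.distOf_eq_map x, ← eq_of_wassersteinTwo_sq_eq_zero hzero,
    ← distOf_locDensity]
  rfl

end Prediction

theorem mainTheorem7 {d : ℕ} (f : EuclideanSpace ℝ (Fin d) → ℝ)
    (hf_meas : Measurable f) (hf_nonneg : ∀ z, 0 ≤ f z)
    (hf_int : ∫ z, f z = 1) (hf_mean : ∫ z, f z • z = 0)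
    (hf_sq : Integrable fun z => ‖z‖ ^ 2 * f z) :
    IsBestEquivariant f (plugIn f fun x => x) ∧
    (∀ q, IsBestEquivariant f q → ∀ x, q x =ᵐ[volume] plugIn f (fun x => x) x) ∧
    IsMinimax f (plugIn f fun x => x) := by
  have hplug := isPredictiveDensity_plugIn_id hf_meas hf_nonneg hf_int
  have hle := wassersteinRisk_plugIn_id_le hf_meas hf_nonneg hf_int hf_sq
  refine ⟨⟨hplug, isEquivariant_plugIn_id f, fun q _ hqe u => (hle u).trans ?_⟩,
    fun q hq x => hq.ae_eq_plugIn_id hf_meas hf_nonneg hf_int hf_mean hf_sq x,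
    ⟨hplug, fun q hq => (iSup_le hle).trans
      (le_iSup_wassersteinRisk hf_meas hf_nonneg hf_int hf_mean hf_sq hq)⟩⟩
  -- For optimality the trivial bound `0 ≤ W₂²` suffices; positive `w` matters only for uniqueness.
  simpa using le_wassersteinRisk_of_isEquivariant hf_meas hf_nonneg hf_int hf_mean hf_sq hqe
    (w := 0) (by simp) u
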